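/- Let $d\ge 2$ be an integer. For a finite set $C\subset\mathbb Z^d$ let $$\Theta_d(C)=\{(x,y)\in\mathbb Z^d\times\mathbb Z^d:\ |x-y|=1,\ x\in C,\ y\notin C\}$$ be its edge boundary, where $|\cdot|$ is the Euclidean norm, and for $n\in\mathbb N$ let $$EIP^d(n)=\min\{\#\Theta_d(C):\ C\subset\mathbb Z^d,\ \#C=n\}.$$ A finite set $C\subset\mathbb Z^d$ is called an $EIP^d$ minimizer if it is empty or if $\#\Theta_d(C)=EIP^d(\#C)$. Let $\ell$ and $p$ be nonnegative integers with $p\le\lfloor \ell^{2^{1-d}}\rfloor$. Then $$P_{\ell,d,p}=\{1,\ldots,\ell-p\}\times\{1,\ldots,\ell\}^{d-1}$$ (the empty set if $\ell=p$) is an $EIP^d$ minimizer. -/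

import Mathlib

/-- The edge boundary `Θ_d(C)` of `C ⊆ ℤ^d`: ordered pairs `(x, y)` of lattice points with
`x ∈ C`, `y ∉ C` and Euclidean distance `|x - y| = 1` (written as `|x - y|² = 1`). -/
def edgeBoundary {d : ℕ} (C : Set (Fin d → ℤ)) : Set ((Fin d → ℤ) × (Fin d → ℤ)) :=
  {q | ∑ i, (q.1 i - q.2 i) ^ 2 = 1 ∧ q.1 ∈ C ∧ q.2 ∉ C}

/-- A finite configuration has a finite edge boundary, so that the cardinality below is the
true one. -/
theorem edgeBoundary_finite {d : ℕ} (C : Finset (Fin d → ℤ)) :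
    (edgeBoundary (C : Set (Fin d → ℤ))).Finite := by
  have h : ((fun q : (Fin d → ℤ) × (Fin d → ℤ) => (q.1, q.1 - q.2)) ''
      edgeBoundary (C : Set (Fin d → ℤ))).Finite := by
    refine ((C.finite_toSet).prod
      (Set.finite_Icc (fun _ : Fin d => (-1 : ℤ)) (fun _ => 1))).subset ?_
    rintro _ ⟨⟨x, y⟩, ⟨h1, hx, -⟩, rfl⟩
    have key : ∀ i, (x i - y i) ^ 2 ≤ 1 := fun i => by
      rw [← h1]
      exact Finset.single_le_sum (f := fun i => (x i - y i) ^ 2)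
        (fun j _ => sq_nonneg _) (Finset.mem_univ i)
    exact ⟨hx, fun i => (abs_le.1 ((sq_le_one_iff_abs_le_one _).1 (key i))).1,
      fun i => (abs_le.1 ((sq_le_one_iff_abs_le_one _).1 (key i))).2⟩
  refine Set.Finite.of_finite_image h ?_
  rintro ⟨x, y⟩ - ⟨x', y'⟩ - he
  obtain ⟨h1, h2⟩ := Prod.ext_iff.1 he
  dsimp only at h1 h2
  subst h1
  exact Prod.ext rfl (sub_right_injective h2)

/-- The edge perimeter `#Θ_d(C)` of a finite configuration `C`. -/
noncomputable def edgePerimeter {d : ℕ} (C : Finset (Fin d → ℤ)) : ℕ :=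
  (edgeBoundary (C : Set (Fin d → ℤ))).ncard

/-- `EIP^d(n)`: the minimal edge perimeter among the configurations of `n` points of `ℤ^d`. -/
noncomputable def EIP (d n : ℕ) : ℕ :=
  sInf {m | ∃ C : Finset (Fin d → ℤ), C.card = n ∧ edgePerimeter C = m}

/-- `C` is an `EIP^d` minimizer; by convention the empty configuration is one. -/
def IsEIPMinimizer {d : ℕ} (C : Finset (Fin d → ℤ)) : Prop :=
  C = ∅ ∨ edgePerimeter C = EIP d C.card

/-- `h_{ℓ,d} = ℓ^(2^(1-d))`. -/
noncomputable def hParam (ℓ d : ℕ) : ℝ :=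
  (ℓ : ℝ) ^ ((2 : ℝ) ^ (1 - (d : ℝ)))

/-- The box `{1,…,ℓ-p} × {1,…,ℓ}^(d-1)`; coordinates are indexed from `0`. -/
noncomputable def boxP (ℓ d p : ℕ) : Finset (Fin d → ℤ) :=
  Fintype.piFinset fun i : Fin d => Finset.Icc 1 (if (i : ℕ) = 0 then (ℓ : ℤ) - p else ℓ)

/-! Grow configurations greedily: fill a balanced box (sides differing by at most one), then cover
one of its faces by the same process one dimension lower. Half the perimeter obtained this way is
`cascade d n`. The theorem follows from two facts: every configuration of n points has perimeter at
least `2 * cascade d n` (`two_mul_cascade_le_edgePerimeter`), and half the perimeter of the given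
box is at most the cascade value (`le_cascade_of_pow_le`).

For the first fact, the perimeter is at least twice the number of coordinate lines meeting C. In the
direction with the most nonempty slices, remove a smallest slice: lines in the other directions
split additively between the slice and the rest. Induction then needs only cascade_{d+1}(n) ≤
cascade_{d+1}(n - m) + cascade_d(m) for a slice of at most average size m. This is proved together
with subadditivity and an exchange inequality by induction on the dimension
(`cascade_exchange_subadditive_slice`).

For the second fact, encode a box with sides ℓ - z_i by the polynomial ∏ (X - z_i): its value at ℓ
is the volume and its derivative there is half the surface. The given box is X^d - p X^(d-1).
Peeling the balanced box off the cascade leaves ℓ^(d-1) - g(ℓ) points, where g again has small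
coefficients, so one inducts over all such polynomials (`CascadeDerivBound.succ`). Each peeling
essentially squares the coefficient bound; after d - 1 peelings p^(2^(d-1)) is compared with ℓ,
whence the exponent 2^(1-d). -/

/-! ### Balanced boxes -/

/-- The volume of the balanced box in dimension `d` with side lengths summing to `N`. -/
def balVol : ℕ → ℕ → ℕ
  | 0, _ => 1
  | d + 1, N => N / (d + 1) * balVol d (N - N / (d + 1))

/-- Half the surface area of the balanced box in dimension `d` with side lengths summing to `N`. -/
def balSurf : ℕ → ℕ → ℕ
  | 0, _ => 0
  | d + 1, N => balVol d (N - N / (d + 1)) + N / (d + 1) * balSurf d (N - N / (d + 1))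

/-- When one more unit of side sum leaves the shortest side k unchanged, the second shortest side
also equals k. -/
theorem sub_div_div_of_div_succ {d N : ℕ} (h : (N + 1) / (d + 2) = N / (d + 2)) :
    (N - N / (d + 2)) / (d + 1) = N / (d + 2) := by
  have h1 := Nat.div_add_mod N (d + 2)
  have h2 := Nat.div_add_mod (N + 1) (d + 2)
  have h3 := Nat.mod_lt (N + 1) (show 0 < d + 2 by omega)
  rw [h] at h2
  generalize N / (d + 2) = k at *
  have h4 : (d + 2) * k = k * (d + 1) + k := by ring
  have h5 : (k + 1) * (d + 1) = k * (d + 1) + d + 1 := by ring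
  apply Nat.div_eq_of_lt_le <;> omega

theorem succ_div_eq_or (N d : ℕ) :
    (N + 1) / (d + 1) = N / (d + 1) ∨ (N + 1) / (d + 1) = N / (d + 1) + 1 := by
  rw [Nat.succ_div]; split_ifs <;> simp

/-- An extra unit of side sum lengthens one shortest side, so consecutive balanced boxes differ by
one layer over the face `balVol d (N - N / (d + 1))`. -/
theorem balVol_succ_succ (d N : ℕ) :
    balVol (d + 1) (N + 1) = (N / (d + 1) + 1) * balVol d (N - N / (d + 1)) := by
  induction d generalizing N with
  | zero => simp [balVol]
  | succ d ih =>
    rw [balVol]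
    rcases succ_div_eq_or N (d + 1) with h | h
    · have hk := sub_div_div_of_div_succ h
      have hle : N / (d + 1 + 1) ≤ N := Nat.div_le_self _ _
      rw [h, Nat.sub_add_comm hle, ih, balVol, hk]
      ring
    · rw [h, show N + 1 - (N / (d + 1 + 1) + 1) = N - N / (d + 1 + 1) by omega]

theorem balVol_succ_succ_eq_add (d N : ℕ) :
    balVol (d + 1) (N + 1) = balVol (d + 1) N + balVol d (N - N / (d + 1)) := by
  rw [balVol_succ_succ, balVol]; ring

theorem balSurf_succ_succ_eq_add (d N : ℕ) :
    balSurf (d + 1) (N + 1) = balSurf (d + 1) N + balSurf d (N - N / (d + 1)) := by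
  induction d generalizing N with
  | zero => simp [balSurf, balVol]
  | succ d ih =>
    rw [balSurf]
    rcases succ_div_eq_or N (d + 1) with h | h
    · have hk := sub_div_div_of_div_succ h
      have hle : N / (d + 1 + 1) ≤ N := Nat.div_le_self _ _
      rw [h, Nat.sub_add_comm hle, ih,
        balVol_succ_succ_eq_add, hk, balSurf.eq_2 N (d + 1), balSurf.eq_2 _ d, hk]
      ring
    · rw [h, show N + 1 - (N / (d + 1 + 1) + 1) = N - N / (d + 1 + 1) by omega,
        balSurf.eq_2 N (d + 1)]
      ring

theorem sub_div_mono (d : ℕ) : Monotone fun N => N - N / (d + 1) := by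
  refine monotone_nat_of_le_succ fun N => ?_
  rcases succ_div_eq_or N d with h | h <;> simp only [h] <;> omega

theorem balVol_mono (d : ℕ) : Monotone (balVol d) := by
  cases d with
  | zero => intro a b _; simp [balVol]
  | succ d =>
    refine monotone_nat_of_le_succ fun N => ?_
    rw [balVol_succ_succ_eq_add]; omega

theorem balFace_mono (d : ℕ) : Monotone fun N => balVol d (N - N / (d + 1)) :=
  (balVol_mono d).comp (sub_div_mono d)

theorem balVol_mul (d ℓ : ℕ) : balVol d (d * ℓ) = ℓ ^ d := by
  induction d with
  | zero => simp [balVol]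
  | succ d ih =>
    rw [balVol, Nat.mul_div_cancel_left _ (by omega),
      show (d + 1) * ℓ - ℓ = d * ℓ by rw [Nat.succ_mul]; omega, ih, pow_succ']

theorem balSurf_mul (d ℓ : ℕ) : balSurf d (d * ℓ) = d * ℓ ^ (d - 1) := by
  induction d with
  | zero => simp [balSurf]
  | succ d ih =>
    rw [balSurf, Nat.mul_div_cancel_left _ (by omega),
      show (d + 1) * ℓ - ℓ = d * ℓ by rw [Nat.succ_mul]; omega, ih, balVol_mul]
    rcases d with _ | d
    · simp
    · simp [pow_succ]; ring

theorem balVol_pos {d N : ℕ} (h : d ≤ N) : 0 < balVol d N := by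
  have := balVol_mono d h
  have h2 := balVol_mul d 1
  simp at h2; omega

theorem le_of_balVol_pos {d N : ℕ} (h : 0 < balVol (d + 1) N) : d + 1 ≤ N := by
  by_contra hc
  rw [balVol, Nat.div_eq_of_lt (by omega)] at h
  simp at h

theorem balFace_pos {d N : ℕ} (h : d ≤ N) : 0 < balVol d (N - N / (d + 1)) := by
  have h1 := balFace_mono d h
  have h2 : d / (d + 1) = 0 := Nat.div_eq_of_lt (by omega)
  have := balVol_pos (le_refl d)
  simp only [h2] at h1
  simp at h1; omega

theorem balVol_succ_le_one {d N : ℕ} (h : balVol (d + 1) N = 0) : balVol (d + 1) (N + 1) ≤ 1 := by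
  have h1 : N < d + 1 := by
    by_contra hc
    have := balVol_pos (not_lt.1 hc); omega
  have := balVol_mono (d + 1) (show N + 1 ≤ d + 1 by omega)
  have h2 := balVol_mul (d + 1) 1
  simp at h2; omega

theorem exists_balVol_lt_le {d n : ℕ} (hn : 0 < n) :
    ∃ N, d ≤ N ∧ balVol (d + 1) N < n ∧ n ≤ balVol (d + 1) (N + 1) := by
  classical
  have hex : ∃ N, n ≤ balVol (d + 1) N := by
    refine ⟨(d + 1) * n, ?_⟩
    rw [balVol_mul]; exact Nat.le_self_pow (by omega) n
  have hspec := Nat.find_spec hex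
  have hmin := fun m => Nat.find_min (m := m) hex
  generalize Nat.find hex = K at *
  have hK := le_of_balVol_pos (lt_of_lt_of_le hn hspec)
  obtain ⟨N, rfl⟩ : ∃ N, K = N + 1 := ⟨K - 1, by omega⟩
  exact ⟨N, by omega, not_le.1 (hmin N (by omega)), hspec⟩

/-! ### The cascade function -/

/-- The largest `N` with `balVol (d + 1) N < n` (for positive `n`). -/
noncomputable def balIdx (d n : ℕ) : ℕ :=
  sInf {N | n ≤ balVol (d + 1) (N + 1)}

theorem balIdx_eq {d n N : ℕ} (h1 : balVol (d + 1) N < n) (h2 : n ≤ balVol (d + 1) (N + 1)) :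
    balIdx d n = N := by
  apply le_antisymm
  · exact Nat.sInf_le h2
  · refine le_csInf ⟨N, h2⟩ fun M hM => ?_
    by_contra hc
    have := balVol_mono (d + 1) (show M + 1 ≤ N by omega)
    simp only [Set.mem_ofPred_eq] at hM
    omega

/-- Half the perimeter of the configuration of `n` points obtained by growing balanced boxes,
filling the faces in the same fashion one dimension lower. -/
noncomputable def cascade : ℕ → ℕ → ℕ
  | 0, _ => 0
  | d + 1, n => if n = 0 then 0 else
      balSurf (d + 1) (balIdx d n) + cascade d (n - balVol (d + 1) (balIdx d n))

@[simp] theorem cascade_zero_right (d : ℕ) : cascade d 0 = 0 := by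
  cases d <;> simp [cascade]

@[simp] theorem cascade_zero_left (n : ℕ) : cascade 0 n = 0 := rfl

theorem cascade_of_lt {d n N : ℕ} (h1 : balVol (d + 1) N < n)
    (h2 : n ≤ balVol (d + 1) (N + 1)) :
    cascade (d + 1) n = balSurf (d + 1) N + cascade d (n - balVol (d + 1) N) := by
  rw [cascade, if_neg (by omega), balIdx_eq h1 h2]

theorem cascade_balVol {d N : ℕ} (h : 0 < balVol d N) : cascade d (balVol d N) = balSurf d N := by
  induction d generalizing N with
  | zero => simp [balSurf]
  | succ d ih =>
    have hN := le_of_balVol_pos h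
    obtain ⟨N, rfl⟩ : ∃ K, N = K + 1 := ⟨N - 1, by omega⟩
    have hf := balFace_pos (show d ≤ N by omega)
    have hs := balVol_succ_succ_eq_add d N
    rw [cascade_of_lt (N := N) (by omega) le_rfl, balSurf_succ_succ_eq_add, ← ih hf, hs,
      Nat.add_sub_cancel_left]

theorem cascade_of_le {d n N : ℕ} (h0 : 0 < n) (h1 : balVol (d + 1) N ≤ n)
    (h2 : n ≤ balVol (d + 1) (N + 1)) :
    cascade (d + 1) n = balSurf (d + 1) N + cascade d (n - balVol (d + 1) N) := by
  rcases h1.lt_or_eq with h | h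
  · exact cascade_of_lt h h2
  · subst h; simp [cascade_balVol h0]

/-- Only an inequality survives at n = 0: a degenerate box of volume 0 may have positive `balSurf`.
-/
theorem cascade_le {d n N : ℕ} (h1 : balVol (d + 1) N ≤ n)
    (h2 : n ≤ balVol (d + 1) (N + 1)) :
    cascade (d + 1) n ≤ balSurf (d + 1) N + cascade d (n - balVol (d + 1) N) := by
  rcases Nat.eq_zero_or_pos n with rfl | h0
  · simp
  · exact (cascade_of_le h0 h1 h2).le

theorem cascade_one (d : ℕ) : cascade d 1 = d := by
  have h := balVol_mul d 1
  have h2 := balSurf_mul d 1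
  have h3 := cascade_balVol (d := d) (N := d * 1) (by rw [h]; simp)
  rw [h, h2] at h3
  simpa using h3

theorem cascade_pow {d ℓ : ℕ} (h : 0 < ℓ) : cascade d (ℓ ^ d) = d * ℓ ^ (d - 1) := by
  rw [← balVol_mul, cascade_balVol, balSurf_mul]
  rw [balVol_mul]; positivity

theorem le_of_balVol_lt {d M N : ℕ} (h : balVol d M < balVol d (N + 1)) : M ≤ N := by
  by_contra hc
  have := balVol_mono d (show N + 1 ≤ M by omega)
  omega

/-! ### Exchange, subadditivity and slice inequalities, by induction on the dimension -/

/-- Removing `u` points costs least at a full balanced box. -/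
def CascadeExchange (d : ℕ) : Prop :=
  ∀ N u y, u ≤ y → y ≤ balVol d N →
    cascade d (balVol d N) + cascade d (y - u) ≤ cascade d (balVol d N - u) + cascade d y

/-- Subadditivity of the cascade function. -/
def CascadeSubadditive (d : ℕ) : Prop :=
  ∀ x y, cascade d (x + y) ≤ cascade d x + cascade d y

/-- Write y as a full box plus w points on a face. If u ≤ w, the removal stays in that face and
exchange in dimension d applies. Otherwise remove the w points, then u - w from the full box by
induction; subadditivity in dimension d combines the two drops. -/
theorem cascade_drop_ge_face_drop {d : ℕ} (hE : CascadeExchange d) (hS : CascadeSubadditive d)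
    (N u : ℕ) (hu : u ≤ balVol d (N - N / (d + 1))) (y : ℕ) (huy : u ≤ y)
    (hy : y ≤ balVol (d + 1) (N + 1)) :
    cascade d (balVol d (N - N / (d + 1))) + cascade (d + 1) (y - u) ≤
      cascade d (balVol d (N - N / (d + 1)) - u) + cascade (d + 1) y := by
  induction y using Nat.strong_induction_on generalizing u with
  | _ y ih =>
  rcases Nat.eq_zero_or_pos y with rfl | hy0
  · obtain rfl : u = 0 := by omega
    simp
  obtain ⟨M, -, hM1, hM2⟩ := exists_balVol_lt_le (d := d) hy0
  have hMN : M ≤ N := le_of_balVol_lt (lt_of_lt_of_le hM1 hy)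
  have hface : balVol d (M - M / (d + 1)) ≤ balVol d (N - N / (d + 1)) := balFace_mono d hMN
  have hMs := balVol_succ_succ_eq_add d M
  have hgy := cascade_of_lt hM1 hM2
  obtain ⟨w, rfl⟩ : ∃ w, y = balVol (d + 1) M + w := ⟨y - balVol (d + 1) M, by omega⟩
  rw [Nat.add_sub_cancel_left] at hgy
  by_cases huw : u ≤ w
  · have h1 := cascade_le (d := d) (n := balVol (d + 1) M + w - u) (N := M) (by omega) (by omega)
    rw [show balVol (d + 1) M + w - u - balVol (d + 1) M = w - u by omega] at h1
    have h2 := hE (N - N / (d + 1)) u w huw (by omega)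
    omega
  · have h1 := ih (balVol (d + 1) M) (by omega) (u - w) (by omega) (by omega)
      (by omega)
    have h2 := cascade_le (d := d) (n := balVol (d + 1) M) (N := M) le_rfl (by omega)
    have h3 := hS (balVol d (N - N / (d + 1)) - u) w
    rw [show balVol d (N - N / (d + 1)) - u + w = balVol d (N - N / (d + 1)) - (u - w)
      by omega] at h3
    rw [show balVol (d + 1) M + w - u = balVol (d + 1) M - (u - w) by omega]
    simp at h2
    omega

theorem cascadeExchange_zero : CascadeExchange 0 := by
  intro N u y _ _; simp

theorem cascadeSubadditive_zero : CascadeSubadditive 0 := by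
  intro x y; simp

theorem CascadeExchange.succ {d : ℕ} (hE : CascadeExchange d) (hS : CascadeSubadditive d) :
    CascadeExchange (d + 1) := by
  intro N
  induction N with
  | zero =>
    intro u y hu hy
    have : balVol (d + 1) 0 = 0 := by simp [balVol]
    rw [this] at hy ⊢
    obtain rfl : y = 0 := by omega
    simp
  | succ N ih =>
    intro u y hu hy
    have hs := balVol_succ_succ_eq_add d N
    rcases Nat.eq_zero_or_pos (balVol (d + 1) N) with h0 | h0
    · have h1 := balVol_succ_le_one h0
      rcases Nat.eq_zero_or_pos u with rfl | hu0
      · simp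
      · have hy1 : y = balVol (d + 1) (N + 1) := by omega
        rw [hy1]; omega
    · have hA := cascade_of_le (d := d) (n := balVol (d + 1) (N + 1)) (N := N) (by omega)
        (by omega) le_rfl
      rw [hs, Nat.add_sub_cancel_left, ← hs] at hA
      have hA' := cascade_of_le (d := d) (n := balVol (d + 1) N) (N := N) (by omega)
        (by omega) (by omega)
      simp at hA'
      by_cases hub : u ≤ balVol d (N - N / (d + 1))
      · have h1 := cascade_drop_ge_face_drop hE hS N u hub y hu hy
        have h2 := cascade_of_le (d := d) (n := balVol (d + 1) (N + 1) - u) (N := N) (by omega)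
          (by omega) (by omega)
        rw [show balVol (d + 1) (N + 1) - u - balVol (d + 1) N
          = balVol d (N - N / (d + 1)) - u by omega] at h2
        omega
      -- More than the outer layer is removed: strip that whole layer first, then use the smaller
      -- full box.
      · have h1 := cascade_drop_ge_face_drop hE hS N _ le_rfl y (by omega) hy
        have h2 := ih (u - balVol d (N - N / (d + 1))) (y - balVol d (N - N / (d + 1)))
          (by omega) (by omega)
        rw [show y - balVol d (N - N / (d + 1)) - (u - balVol d (N - N / (d + 1))) = y - u
          by omega, show balVol (d + 1) N - (u - balVol d (N - N / (d + 1)))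
          = balVol (d + 1) (N + 1) - u by omega] at h2
        simp at h1
        omega

/-- Removing a slice of at most average size from a configuration of `n` points. -/
def CascadeSlice (d : ℕ) : Prop :=
  ∀ N n m, balVol (d + 1) N < n → n ≤ balVol (d + 1) (N + 1) → m < n →
    m * (N / (d + 1) + 1) ≤ n → cascade (d + 1) n ≤ cascade (d + 1) (n - m) + cascade d m

/-- Let r points lie on the current face, and let A be the size of the last completed layer.
Subadditivity settles m ≤ r, exchange at A settles r < m ≤ A, and for m > A the slice inequality one
dimension lower applies to r and m - A. -/
theorem cascadeSlice_of {d : ℕ} (hE : CascadeExchange d) (hS : CascadeSubadditive d)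
    (hR : ∀ e, d = e + 1 → CascadeSlice e) : CascadeSlice d := by
  intro N n m h1 h2 hmn hm
  have hs := balVol_succ_succ_eq_add d N
  have hgn := cascade_of_lt h1 h2
  rcases Nat.eq_zero_or_pos (balVol (d + 1) N) with h0 | h0
  · have := balVol_succ_le_one h0
    obtain rfl : m = 0 := by omega
    simp
  obtain ⟨r, rfl⟩ : ∃ r, n = balVol (d + 1) N + r := ⟨n - balVol (d + 1) N, by omega⟩
  rw [Nat.add_sub_cancel_left] at hgn
  by_cases hmr : m ≤ r
  · have h3 := cascade_of_le (d := d) (n := balVol (d + 1) N + r - m) (N := N) (by omega)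
      (by omega) (by omega)
    rw [show balVol (d + 1) N + r - m - balVol (d + 1) N = r - m by omega] at h3
    have h4 := hS (r - m) m
    rw [Nat.sub_add_cancel hmr] at h4
    omega
  have hNd := le_of_balVol_pos h0
  obtain ⟨L, rfl⟩ : ∃ L, N = L + 1 := ⟨N - 1, by omega⟩
  have hsL := balVol_succ_succ_eq_add d L
  have htL := balSurf_succ_succ_eq_add d L
  have hfpos := balFace_pos (show d ≤ L by omega)
  have hfL := cascade_balVol hfpos
  by_cases hmA : m ≤ balVol d (L - L / (d + 1))
  · have h3 := cascade_of_lt (d := d) (n := balVol (d + 1) (L + 1) + r - m) (N := L) (by omega)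
      (by omega)
    rw [show balVol (d + 1) (L + 1) + r - m - balVol (d + 1) L
      = balVol d (L - L / (d + 1)) - (m - r) by omega] at h3
    have h4 := hE (L - L / (d + 1)) (m - r) m (by omega) hmA
    rw [show m - (m - r) = r by omega] at h4
    omega
  have hmF : m ≤ balVol d (L + 1 - (L + 1) / (d + 1)) := by
    rw [balVol_succ_succ d (L + 1)] at h2
    have h3 := hm.trans h2
    rw [mul_comm m] at h3
    exact Nat.le_of_mul_le_mul_left h3 (Nat.succ_pos _)
  -- If the shortest side grew here, the next face would have size A, contradicting A < m ≤ next
  -- face.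
  have hk : (L + 1) / (d + 1) = L / (d + 1) := by
    rcases succ_div_eq_or L d with h | h
    · exact h
    · rw [h, Nat.add_sub_add_right] at hmF
      omega
  have hV := balVol_succ_succ d L
  have hkpos : 1 ≤ L / (d + 1) := by
    rw [← hk]; exact Nat.div_pos hNd (by omega)
  have hkL : L / (d + 1) ≤ L := Nat.div_le_self _ _
  rw [hk] at hm hs hmF
  rw [show L + 1 - L / (d + 1) = (L - L / (d + 1)) + 1 by omega] at hmF hs
  cases d with
  | zero => simp [balVol] at hmF hmA; omega
  | succ e =>
    have hk2 := sub_div_div_of_div_succ hk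
    generalize hA : balVol (e + 1) (L - L / (e + 1 + 1)) = A at *
    obtain ⟨m', rfl⟩ : ∃ m', m = A + m' := ⟨m - A, by omega⟩
    -- The full box consists of exactly k + 1 layers of size A, where k = `L / (e + 1 + 1)`, so A
    -- cancels from the average-size condition.
    have hm' : m' * (L / (e + 1 + 1) + 1) ≤ r := by
      rw [hV, add_mul, mul_comm A] at hm; omega
    have hm2 : 2 * m' ≤ r := by nlinarith
    have h3 := cascade_of_lt (d := e + 1) (n := balVol (e + 1 + 1) (L + 1) + r - (A + m'))
      (N := L) (by omega) (by omega)
    rw [show balVol (e + 1 + 1) (L + 1) + r - (A + m') - balVol (e + 1 + 1) L = r - m'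
      by omega] at h3
    have h4 := cascade_of_lt (d := e) (n := A + m') (N := L - L / (e + 1 + 1)) (by omega) hmF
    rw [hA, Nat.add_sub_cancel_left] at h4
    obtain ⟨K, -, hK1, hK2⟩ := exists_balVol_lt_le (d := e) (n := r) (by omega)
    have hKL : K ≤ L - L / (e + 1 + 1) :=
      le_of_balVol_lt (lt_of_lt_of_le hK1 (by omega))
    have hKd : K / (e + 1) ≤ L / (e + 1 + 1) := hk2 ▸ Nat.div_le_div_right hKL
    have h5 := hR e rfl K r m' hK1 hK2 (by omega)
      ((Nat.mul_le_mul_left _ (by omega)).trans hm')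
    omega

/-- With y ≤ x, write y as a full box plus w points on a face. The w points are added to x as a
slice, and the box, being smaller than y, is added by induction. -/
theorem CascadeSlice.subadditive {d : ℕ} (hR : CascadeSlice d) : CascadeSubadditive (d + 1) := by
  suffices h : ∀ y x, y ≤ x → cascade (d + 1) (x + y) ≤ cascade (d + 1) x + cascade (d + 1) y by
    intro x y
    rcases le_total y x with hxy | hxy
    · exact h y x hxy
    · rw [add_comm x, add_comm (cascade _ x)]; exact h x y hxy
  intro y
  induction y using Nat.strong_induction_on with
  | _ y ih =>
  intro x hyx
  rcases Nat.eq_zero_or_pos y with rfl | hy0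
  · simp
  obtain ⟨M, hMd, hM1, hM2⟩ := exists_balVol_lt_le (d := d) hy0
  obtain ⟨N, hNd, hN1, hN2⟩ := exists_balVol_lt_le (d := d) (hy0.trans_le hyx)
  have hMN : M ≤ N := le_of_balVol_lt (hM1.trans_le (hyx.trans hN2))
  have hgy := cascade_of_lt hM1 hM2
  have hMs := balVol_succ_succ_eq_add d M
  have hQ := cascade_le (d := d) (n := balVol (d + 1) M) (N := M) le_rfl (by omega)
  have hface : balVol d (M - M / (d + 1)) ≤ balVol d (N - N / (d + 1)) := balFace_mono d hMN
  obtain ⟨w, rfl⟩ : ∃ w, y = balVol (d + 1) M + w := ⟨y - balVol (d + 1) M, by omega⟩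
  rw [Nat.add_sub_cancel_left] at hgy
  have h1 := ih (balVol (d + 1) M) (by omega) (x + w) (by omega)
  suffices h2 : cascade (d + 1) (x + w) ≤ cascade (d + 1) x + cascade d w by
    rw [show x + (balVol (d + 1) M + w) = x + w + balVol (d + 1) M by ring]
    simp at hQ
    omega
  have hwk : w * (N / (d + 1)) < x := by
    refine lt_of_le_of_lt ?_ hN1
    rw [balVol, mul_comm]
    exact Nat.mul_le_mul_left _ (by omega)
  have hNs := balVol_succ_succ_eq_add d N
  by_cases hx : x + w ≤ balVol (d + 1) (N + 1)
  · have := hR N (x + w) w (by omega) hx (by omega) (by rw [mul_add]; omega)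
    simpa using this
  · have hf : balVol d (N - N / (d + 1)) ≤ balVol d (N + 1 - (N + 1) / (d + 1)) :=
      balFace_mono d (Nat.le_succ N)
    have hNs2 := balVol_succ_succ_eq_add d (N + 1)
    have := hR (N + 1) (x + w) w (by omega) (by omega) (by omega) ?_
    · simpa using this
    rcases succ_div_eq_or N d with h | h
    · rw [h, mul_add]; omega
    -- Adding w overflows into the next layer just as the shortest side grows, so a stronger size
    -- bound on w is needed.
    · rw [h, mul_add, mul_one]
      suffices w * (N / (d + 1) + 1) ≤ x by omega
      rcases hMN.lt_or_eq with hlt | rfl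
      · obtain ⟨L, rfl⟩ : ∃ L, N = L + 1 := ⟨N - 1, by omega⟩
        have hwL : w ≤ balVol d (L - L / (d + 1)) :=
          le_trans (show w ≤ balVol d (M - M / (d + 1)) by omega)
            (balFace_mono d (show M ≤ L by omega))
        cases d with
        | zero => simp [balVol] at hwL hN1 ⊢; nlinarith
        | succ e =>
          -- In dimension at least two the shortest side cannot grow at two consecutive side sums.
          have hk : (L + 1) / (e + 1 + 1) = L / (e + 1 + 1) := by
            rcases succ_div_eq_or L (e + 1) with h' | h'
            · exact h'
            · exfalso
              have e1 := Nat.div_add_mod L (e + 1 + 1)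
              have e2 := Nat.div_add_mod (L + 1 + 1) (e + 1 + 1)
              have e3 := Nat.mod_lt L (show 0 < e + 1 + 1 by omega)
              rw [h, h'] at e2
              generalize L / (e + 1 + 1) = k at *
              have : (e + 1 + 1) * (k + 1 + 1) = (e + 1 + 1) * k + 2 * e + 4 := by ring
              omega
          have hV := balVol_succ_succ (e + 1) L
          rw [hk]
          refine le_of_lt (lt_of_le_of_lt ?_ hN1)
          rw [hV, mul_comm]
          exact Nat.mul_le_mul_left _ hwL
      · rw [mul_add, mul_one]
        have : w * (M / (d + 1)) ≤ balVol (d + 1) M := by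
          rw [balVol, mul_comm]
          exact Nat.mul_le_mul_left _ (by omega)
        omega

theorem cascade_exchange_subadditive_slice (d : ℕ) :
    CascadeExchange d ∧ CascadeSubadditive d ∧ CascadeSlice d := by
  induction d with
  | zero =>
    exact ⟨cascadeExchange_zero, cascadeSubadditive_zero,
      cascadeSlice_of cascadeExchange_zero cascadeSubadditive_zero (by simp)⟩
  | succ d ih =>
    obtain ⟨hE, hS, hR⟩ := ih
    refine ⟨hE.succ hS, hR.subadditive, cascadeSlice_of (hE.succ hS) hR.subadditive ?_⟩
    intro e he
    obtain rfl : d = e := by omega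
    exact hR

/-- Since n ≤ b^(d+1), the box being completed is no larger than the cube of side b, so its shortest
side before completion is less than b. -/
theorem cascade_le_of_slice {d n m b : ℕ} (hm : m < n) (hb : m * b ≤ n) (hn : n ≤ b ^ (d + 1)) :
    cascade (d + 1) n ≤ cascade (d + 1) (n - m) + cascade d m := by
  obtain ⟨N, -, hN1, hN2⟩ := exists_balVol_lt_le (d := d) (n := n) (by omega)
  refine (cascade_exchange_subadditive_slice d).2.2 N n m hN1 hN2 hm
    (le_trans (Nat.mul_le_mul_left _ ?_) hb)
  rw [← balVol_mul] at hn
  have : N < (d + 1) * b := by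
    by_contra hc
    have := balVol_mono (d + 1) (not_lt.1 hc)
    omega
  exact Nat.div_lt_of_lt_mul this

/-! ### Lower bound for the number of lines meeting a configuration -/

open Finset in
theorem exists_fiber_card_mul_le {α β : Type*} [DecidableEq β] (C : Finset α) (f : α → β)
    (hC : C.Nonempty) :
    ∃ t ∈ C.image f, (C.filter fun x => f x = t).card * (C.image f).card ≤ C.card := by
  obtain ⟨t, ht, hmin⟩ := exists_min_image (C.image f) (fun t => (C.filter fun x => f x = t).card)
    (hC.image f)
  refine ⟨t, ht, ?_⟩
  rw [card_eq_sum_card_image f C, mul_comm, ← smul_eq_mul]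
  exact card_nsmul_le_sum _ _ _ hmin

/-- The number of lines in the coordinate direction `i` that meet `C`. -/
def lineCount {ι : Type*} [Fintype ι] [DecidableEq ι] (C : Finset (ι → ℤ)) (i : ι) : ℕ :=
  (C.image fun x => Function.update x i 0).card

theorem card_le_prod_card_image {ι : Type*} [DecidableEq ι] (I : Finset ι) (C : Finset (ι → ℤ))
    (hI : ∀ x ∈ C, ∀ y ∈ C, ∀ j ∉ I, x j = y j) :
    C.card ≤ ∏ i ∈ I, (C.image fun x => x i).card := by
  rw [← Finset.card_pi]
  refine Finset.card_le_card_of_injOn (fun x i _ => x i) ?_ ?_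
  · intro x hx
    simp only [Finset.mem_coe, Finset.mem_pi]
    exact fun i _ => Finset.mem_image_of_mem _ hx
  · intro x hx y hy hxy
    funext j
    by_cases hj : j ∈ I
    · exact congrFun (congrFun hxy j) hj
    · exact hI x hx y hy j hj

theorem lineCount_eq_add {ι : Type*} [Fintype ι] [DecidableEq ι] (C : Finset (ι → ℤ)) {i j : ι} (hij : j ≠ i)
    (t : ℤ) :
    lineCount C j = lineCount (C.filter fun x => ¬ x i = t) j
      + lineCount (C.filter fun x => x i = t) j := by
  rw [lineCount, lineCount, lineCount, ← Finset.card_union_of_disjoint, ← Finset.image_union,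
    Finset.union_comm, Finset.filter_union_filter_not_eq]
  rw [Finset.disjoint_left]
  intro z hz hz'
  simp only [Finset.mem_image, Finset.mem_filter] at hz hz'
  obtain ⟨x, ⟨-, hx⟩, rfl⟩ := hz
  obtain ⟨y, ⟨-, hy⟩, hxy⟩ := hz'
  have := congrFun hxy i
  simp only [Function.update_of_ne hij.symm] at this
  exact hx (this ▸ hy)

theorem lineCount_mono {ι : Type*} [Fintype ι] [DecidableEq ι] {C D : Finset (ι → ℤ)} (h : C ⊆ D) (i : ι) :
    lineCount C i ≤ lineCount D i :=
  Finset.card_le_card (Finset.image_subset_image h)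

theorem cascade_card_le_sum_lineCount {ι : Type*} [Fintype ι] [DecidableEq ι] (n : ℕ) (I : Finset ι)
    (C : Finset (ι → ℤ)) (hn : C.card = n) (hI : ∀ x ∈ C, ∀ y ∈ C, ∀ j ∉ I, x j = y j) :
    cascade I.card n ≤ ∑ i ∈ I, lineCount C i := by
  induction n using Nat.strong_induction_on generalizing I C with
  | _ n ih =>
  rcases Nat.eq_zero_or_pos n with rfl | hn0
  · simp
  have hne : C.Nonempty := Finset.card_pos.1 (by omega)
  -- A single point is its own slice, so removing a slice gives a genuine split only from two points
  -- on.
  rcases Nat.lt_or_ge n 2 with h1 | h2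
  · obtain rfl : n = 1 := by omega
    rw [cascade_one, Finset.card_eq_sum_ones]
    exact Finset.sum_le_sum fun i _ => Finset.card_pos.2 (hne.image _)
  have hprod := card_le_prod_card_image I C hI
  have hIne : I.Nonempty := by
    by_contra hc
    rw [Finset.not_nonempty_iff_eq_empty] at hc
    subst hc
    simp at hprod; omega
  -- Maximality of the number b of slices gives n ≤ b^|I|, as `cascade_le_of_slice` requires.
  obtain ⟨i, hi, hmax⟩ := Finset.exists_max_image I (fun i => (C.image fun x => x i).card) hIne
  have hpow : n ≤ (C.image fun x => x i).card ^ I.card := by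
    rw [← hn]
    exact hprod.trans (Finset.prod_le_pow_card _ _ _ hmax)
  obtain ⟨t, ht, hfib⟩ := exists_fiber_card_mul_le C (fun x => x i) hne
  have hb : 2 ≤ (C.image fun x => x i).card := by
    by_contra hc
    have : (C.image fun x => x i).card ^ I.card ≤ 1 := pow_le_one' (by omega) _
    omega
  have hpos : 0 < (C.filter fun x => x i = t).card := by
    obtain ⟨x, hx, hxt⟩ := Finset.mem_image.1 ht
    exact Finset.card_pos.2 ⟨x, Finset.mem_filter.2 ⟨hx, hxt⟩⟩
  have hsplit := Finset.card_filter_add_card_filter_not (s := C) (fun x => x i = t)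
  obtain ⟨d, hd⟩ : ∃ d, I.card = d + 1 := ⟨I.card - 1, by have := hIne.card_pos; omega⟩
  have hde : (I.erase i).card = d := by rw [Finset.card_erase_of_mem hi]; omega
  have hm : (C.filter fun x => x i = t).card < n := by
    have := Nat.mul_le_mul_left (C.filter fun x => x i = t).card hb
    omega
  have hslice := cascade_le_of_slice (d := d) hm (hn ▸ hfib) (hd ▸ hpow)
  have ih1 := ih _ (show (C.filter fun x => ¬ x i = t).card < n by omega) I _ rfl
    (fun x hx y hy j hj => hI x (Finset.mem_filter.1 hx).1 y (Finset.mem_filter.1 hy).1 j hj)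
  have ih2 := ih _ hm (I.erase i) _ rfl (fun x hx y hy j hj => by
    rw [Finset.mem_filter] at hx hy
    rw [Finset.mem_erase, not_and_or, not_not] at hj
    rcases hj with rfl | hj
    · rw [hx.2, hy.2]
    · exact hI x hx.1 y hy.1 j hj)
  rw [hde] at ih2
  rw [hd] at ih1 ⊢
  rw [show n - (C.filter fun x => x i = t).card = (C.filter fun x => ¬ x i = t).card by omega]
    at hslice
  refine hslice.trans ((add_le_add ih1 ih2).trans ?_)
  rw [← Finset.add_sum_erase _ _ hi, ← Finset.add_sum_erase _ _ hi, add_assoc,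
    ← Finset.sum_add_distrib]
  refine add_le_add (lineCount_mono (Finset.filter_subset _ _) i) (Finset.sum_le_sum ?_)
  intro j hj
  exact (lineCount_eq_add C (Finset.ne_of_mem_erase hj) t).ge

/-! ### Edge perimeter, lines and boxes -/

/-- The points of `C` whose translate by `s` in the direction `i` leaves `C`. -/
def exitPoints {ι : Type*} [Fintype ι] [DecidableEq ι] (C : Finset (ι → ℤ)) (i : ι) (s : ℤ) :
    Finset (ι → ℤ) :=
  C.filter fun x => Function.update x i (x i + s) ∉ C

theorem lineCount_le_card_exitPoints {ι : Type*} [Fintype ι] [DecidableEq ι] (C : Finset (ι → ℤ)) (i : ι)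
    {s : ℤ} (hs : s ≠ 0) : lineCount C i ≤ (exitPoints C i s).card := by
  refine le_trans (Finset.card_le_card ?_)
    (Finset.card_image_le (f := fun x => Function.update x i (0 : ℤ)))
  intro z hz
  obtain ⟨x, hx, rfl⟩ := Finset.mem_image.1 hz
  -- The last point of the line in the direction of s is an exit point.
  obtain ⟨y, hy, hmax⟩ := Finset.exists_max_image
    (C.filter fun y => Function.update y i (0 : ℤ) = Function.update x i 0) (fun y => s * y i)
    ⟨x, by simp [hx]⟩
  rw [Finset.mem_filter] at hy
  refine Finset.mem_image.2 ⟨y, Finset.mem_filter.2 ⟨hy.1, fun hc => ?_⟩, hy.2⟩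
  have := hmax _ (Finset.mem_filter.2 ⟨hc, by simp [hy.2]⟩)
  simp only [Function.update_self] at this
  have := mul_self_pos.2 hs
  nlinarith

theorem exists_unit_coordinate {ι : Type*} [Fintype ι] [DecidableEq ι] {x y : ι → ℤ}
    (h : ∑ i, (x i - y i) ^ 2 = 1) :
    ∃ i, ∃ s : ℤˣ, y = Function.update x i (x i + s) := by
  obtain ⟨i, -, hi⟩ : ∃ i ∈ Finset.univ, (x i - y i) ^ 2 ≠ 0 :=
    Finset.exists_ne_zero_of_sum_ne_zero (by rw [h]; exact one_ne_zero)
  rw [← Finset.add_sum_erase _ _ (Finset.mem_univ i)] at h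
  have h0 : 0 ≤ ∑ j ∈ Finset.univ.erase i, (x j - y j) ^ 2 :=
    Finset.sum_nonneg fun j _ => sq_nonneg _
  have h1 : 0 < (x i - y i) ^ 2 := lt_of_le_of_ne (sq_nonneg _) (Ne.symm hi)
  have h2 : ∑ j ∈ Finset.univ.erase i, (x j - y j) ^ 2 = 0 := by omega
  have h3 : (y i - x i) ^ 2 = 1 := by
    rw [← neg_sub, neg_sq]; omega
  rw [Finset.sum_eq_zero_iff_of_nonneg fun j _ => sq_nonneg _] at h2
  have hu : IsUnit (y i - x i) := IsUnit.of_mul_eq_one (y i - x i) (by rw [← sq]; exact h3)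
  obtain ⟨s, hs⟩ := hu
  refine ⟨i, s, funext fun j => ?_⟩
  by_cases hj : j = i
  · subst hj; simp [hs]
  · rw [Function.update_of_ne hj]
    have := h2 j (Finset.mem_erase.2 ⟨hj, Finset.mem_univ j⟩)
    have := pow_eq_zero_iff (two_ne_zero) |>.1 this
    omega

theorem edgePerimeter_eq_sum {d : ℕ} (C : Finset (Fin d → ℤ)) :
    edgePerimeter C = ∑ i, ∑ s : ℤˣ, (exitPoints C i s).card := by
  have himg : edgeBoundary (C : Set (Fin d → ℤ)) =
      (((Finset.univ : Finset (Fin d × ℤˣ)).sigma fun q => exitPoints C q.1 q.2).image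
        fun q => (q.2, Function.update q.2 q.1.1 (q.2 q.1.1 + q.1.2)) :
        Finset ((Fin d → ℤ) × (Fin d → ℤ))) := by
    ext ⟨x, y⟩
    simp only [edgeBoundary, Set.mem_ofPred_eq, Finset.coe_image, Set.mem_image, Finset.mem_coe,
      Finset.mem_sigma, Finset.mem_univ, true_and, exitPoints, Finset.mem_filter, Prod.mk.injEq]
    constructor
    · rintro ⟨h, hx, hy⟩
      obtain ⟨i, s, rfl⟩ := exists_unit_coordinate h
      exact ⟨⟨(i, s), x⟩, ⟨hx, hy⟩, rfl, rfl⟩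
    · rintro ⟨⟨⟨i, s⟩, z⟩, ⟨hz, hz'⟩, rfl, rfl⟩
      refine ⟨?_, hz, hz'⟩
      rw [Finset.sum_eq_single i]
      · simp only [Function.update_self, sub_add_cancel_left, neg_sq]
        rw [← Units.val_pow_eq_pow_val, Int.units_sq, Units.val_one]
      · intro j _ hj
        simp [Function.update_of_ne hj]
      · simp
  rw [edgePerimeter, himg, Set.ncard_coe_finset, Finset.card_image_of_injOn, Finset.card_sigma,
    Fintype.sum_prod_type]
  rintro ⟨⟨i, s⟩, x⟩ - ⟨⟨j, t⟩, y⟩ - h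
  simp only [Prod.mk.injEq] at h
  obtain ⟨rfl, h⟩ := h
  have hi := congrFun h i
  have hst : i = j := by
    by_contra hij
    rw [Function.update_self, Function.update_of_ne hij] at hi
    exact s.ne_zero (by omega)
  subst hst
  simp only [Function.update_self, add_right_inj, Units.val_inj] at hi
  rw [hi]

theorem two_mul_cascade_le_edgePerimeter {d : ℕ} (C : Finset (Fin d → ℤ)) :
    2 * cascade d C.card ≤ edgePerimeter C := by
  have h := cascade_card_le_sum_lineCount C.card Finset.univ C rfl (by simp)
  rw [Finset.card_univ, Fintype.card_fin] at h
  rw [edgePerimeter_eq_sum]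
  refine (Nat.mul_le_mul_left 2 h).trans ?_
  rw [Finset.mul_sum]
  refine Finset.sum_le_sum fun i _ => ?_
  refine le_trans ?_ (Finset.sum_le_sum (f := fun _ => lineCount C i) fun s _ =>
    lineCount_le_card_exitPoints C i s.ne_zero)
  simp

theorem card_exitPoints_piFinset_Icc_le {d : ℕ} (b : Fin d → ℤ) (i : Fin d) (s : ℤˣ) :
    (exitPoints (Fintype.piFinset fun j => Finset.Icc 1 (b j)) i s).card ≤
      ∏ j ∈ Finset.univ.erase i, (b j).toNat := by
  have hsub : exitPoints (Fintype.piFinset fun j => Finset.Icc 1 (b j)) i s ⊆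
      Fintype.piFinset fun j => if j = i then {if s = 1 then b i else 1}
        else Finset.Icc 1 (b j) := by
    intro x hx
    rw [exitPoints, Finset.mem_filter, Fintype.mem_piFinset, Fintype.mem_piFinset] at hx
    obtain ⟨hx, hx'⟩ := hx
    rw [Fintype.mem_piFinset]
    intro j
    by_cases hj : j = i
    · subst hj
      push Not at hx'
      obtain ⟨k, hk⟩ := hx'
      have hkj : k = j := by
        by_contra hkj
        rw [Function.update_of_ne hkj] at hk
        exact hk (hx k)
      subst hkj
      have h1 := hx k
      rw [Function.update_self, Finset.mem_Icc] at hk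
      rw [Finset.mem_Icc] at h1
      rcases Int.units_eq_one_or s with rfl | rfl
      · simp at hk ⊢; omega
      · simp at hk ⊢; omega
    · simpa [hj] using hx j
  refine (Finset.card_le_card hsub).trans ?_
  rw [Fintype.card_piFinset, ← Finset.mul_prod_erase _ _ (Finset.mem_univ i)]
  simp only [if_true, Finset.card_singleton, one_mul]
  refine (Finset.prod_congr rfl fun j hj => ?_).le
  rw [if_neg (Finset.ne_of_mem_erase hj), Int.card_Icc, add_sub_cancel_right]

theorem edgePerimeter_piFinset_Icc_le {d : ℕ} (b : Fin d → ℤ) :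
    edgePerimeter (Fintype.piFinset fun j => Finset.Icc 1 (b j)) ≤
      2 * ∑ i, ∏ j ∈ Finset.univ.erase i, (b j).toNat := by
  rw [edgePerimeter_eq_sum, Finset.mul_sum]
  refine Finset.sum_le_sum fun i _ => ?_
  refine (Finset.sum_le_sum fun s _ => card_exitPoints_piFinset_Icc_le b i s).trans ?_
  simp

theorem isEIPMinimizer_of_le_cascade {d : ℕ} {C : Finset (Fin d → ℤ)}
    (h : edgePerimeter C ≤ 2 * cascade d C.card) : IsEIPMinimizer C := by
  refine Or.inr (le_antisymm ?_ (Nat.sInf_le ⟨C, rfl, rfl⟩))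
  refine le_csInf ⟨_, C, rfl, rfl⟩ ?_
  rintro m ⟨D, hD, rfl⟩
  rw [← hD] at h
  exact h.trans (two_mul_cascade_le_edgePerimeter D)

/-! ### Binomial inequalities and drops of the cascade inside a cube -/

theorem choose_add_mul_choose_le (s z m : ℕ) :
    s.choose (m + 1) + z * s.choose m ≤ (s + z).choose (m + 1) := by
  induction z with
  | zero => simp
  | succ z ih =>
    have h1 := Nat.choose_le_choose m (show s ≤ s + z by omega)
    rw [← add_assoc, Nat.choose_succ_succ', Nat.succ_mul]
    omega

theorem choose_add_choose_le (x y j : ℕ) :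
    x.choose (j + 1) + y.choose (j + 1) ≤ (x + y).choose (j + 1) := by
  induction y with
  | zero => simp
  | succ y ih =>
    have h1 := Nat.choose_le_choose j (show y ≤ x + y by omega)
    rw [← add_assoc, Nat.choose_succ_succ', Nat.choose_succ_succ']
    omega

theorem choose_le_choose_choose_two (a j : ℕ) :
    a.choose (j + 2) ≤ (a.choose 2).choose (j + 1) := by
  induction a with
  | zero => simp
  | succ a ih =>
    have h1 := choose_add_choose_le a (a.choose 2) j
    rw [Nat.choose_succ_succ' a (j + 1), Nat.choose_succ_succ' a 1, Nat.choose_one_right]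
    exact (Nat.add_le_add_left ih _).trans h1

/-- The drop in a cube is at least the drop from its full face, itself a cube of side ℓ. Descend
through faces until the removed ℓ^j points are an entire face, whose cascade value is j ℓ^(j-1). -/
theorem cascade_sub_pow_add_le {ℓ : ℕ} (hℓ : 0 < ℓ) {i j : ℕ} (hj : j < i) {y : ℕ}
    (hy : y ≤ ℓ ^ i) (hjy : ℓ ^ j ≤ y) :
    cascade i (y - ℓ ^ j) + j * ℓ ^ (j - 1) ≤ cascade i y := by
  induction i generalizing y with
  | zero => omega
  | succ i ih =>
    obtain ⟨hE, hS, -⟩ := cascade_exchange_subadditive_slice i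
    obtain ⟨k, rfl⟩ : ∃ k, ℓ = k + 1 := ⟨ℓ - 1, by omega⟩
    have hN : (i + 1) * (k + 1) = ((i + 1) * k + i) + 1 := by ring
    have hdiv : ((i + 1) * k + i) / (i + 1) = k := by
      rw [Nat.mul_add_div (by omega), Nat.div_eq_of_lt (by omega), add_zero]
    have hidx : (i + 1) * k + i - k = i * (k + 1) := by
      rw [Nat.succ_mul, Nat.mul_succ]; omega
    have hle : (k + 1) ^ j ≤ (k + 1) ^ i := Nat.pow_le_pow_right hℓ (by omega)
    have h := cascade_drop_ge_face_drop hE hS ((i + 1) * k + i) ((k + 1) ^ j)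
      (by rwa [hdiv, hidx, balVol_mul]) y hjy (by rwa [← hN, balVol_mul])
    rw [hdiv, hidx, balVol_mul] at h
    rcases (Nat.lt_succ_iff.1 hj).lt_or_eq with hlt | rfl
    · have := ih hlt le_rfl hle
      omega
    · rw [cascade_pow hℓ, Nat.sub_self, cascade_zero_right] at h
      omega

theorem cascade_sub_mul_pow_add_le {ℓ : ℕ} (hℓ : 0 < ℓ) {i j : ℕ} (hj : j < i) (c : ℕ) {y : ℕ}
    (hy : y ≤ ℓ ^ i) (hjy : c * ℓ ^ j ≤ y) :
    cascade i (y - c * ℓ ^ j) + c * (j * ℓ ^ (j - 1)) ≤ cascade i y := by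
  induction c with
  | zero => simp
  | succ c ih =>
    rw [Nat.succ_mul] at hjy ⊢
    have h1 := ih (by omega)
    have h2 := cascade_sub_pow_add_le hℓ hj (y := y - c * ℓ ^ j) (by omega) (by omega)
    rw [Nat.succ_mul, ← Nat.sub_sub]
    omega

theorem cascade_add_sum_pow_le {ℓ : ℕ} (hℓ : 0 < ℓ) {i J : ℕ} (hJ : J ≤ i) (a : ℕ → ℕ) {y : ℕ}
    (hy : y + ∑ j ∈ Finset.range J, a j * ℓ ^ j ≤ ℓ ^ i) :
    cascade i y + ∑ j ∈ Finset.range J, a j * (j * ℓ ^ (j - 1)) ≤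
      cascade i (y + ∑ j ∈ Finset.range J, a j * ℓ ^ j) := by
  induction J with
  | zero => simp
  | succ J ih =>
    rw [Finset.sum_range_succ] at hy ⊢
    have h1 := ih (by omega) (by omega)
    have h2 := cascade_sub_mul_pow_add_le hℓ (show J < i by omega) (a J) hy (by omega)
    rw [← add_assoc, Nat.add_sub_cancel] at h2
    rw [Finset.sum_range_succ, ← add_assoc y]
    omega

theorem div_le_and_sub_div_le {d ℓ N : ℕ} (h : N ≤ (d + 1) * ℓ) :
    N / (d + 1) ≤ ℓ ∧ N - N / (d + 1) ≤ d * ℓ := by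
  refine ⟨Nat.div_le_of_le_mul h, ?_⟩
  have := sub_div_mono d h
  simp only [Nat.mul_div_cancel_left _ (Nat.succ_pos d)] at this
  rwa [Nat.succ_mul, Nat.add_sub_cancel] at this

/-- Each unit cut from a side of the cube removes at most ℓ^d points. -/
theorem pow_le_balVol_add {d ℓ N c : ℕ} (h : N + c = (d + 1) * ℓ) :
    ℓ ^ (d + 1) ≤ balVol (d + 1) N + c * ℓ ^ d := by
  induction d generalizing N c with
  | zero => simp [balVol] at *; omega
  | succ d ih =>
    obtain ⟨h1, h2⟩ := div_le_and_sub_div_le (d := d + 1) (ℓ := ℓ) (N := N) (by omega)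
    have h3 : N / (d + 1 + 1) ≤ N := Nat.div_le_self _ _
    rw [balVol]
    generalize N / (d + 1 + 1) = k at *
    obtain ⟨z, rfl⟩ : ∃ z, ℓ = k + z := ⟨ℓ - k, by omega⟩
    have h4 : (d + 1 + 1) * (k + z) = (d + 1) * (k + z) + k + z := by ring
    obtain ⟨c', rfl⟩ : ∃ c', c = c' + z := ⟨c - z, by omega⟩
    have h5 := ih (N := N - k) (c := c') (by omega)
    calc (k + z) ^ (d + 1 + 1) = k * (k + z) ^ (d + 1) + z * (k + z) ^ (d + 1) := by ring
      _ ≤ k * (balVol (d + 1) (N - k) + c' * (k + z) ^ d) + z * (k + z) ^ (d + 1) := by gcongr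
      _ = k * balVol (d + 1) (N - k) + (c' * k * (k + z) ^ d + z * (k + z) ^ (d + 1)) := by ring
      _ ≤ k * balVol (d + 1) (N - k) + (c' * (k + z) * (k + z) ^ d + z * (k + z) ^ (d + 1)) := by
        gcongr
      _ = _ := by ring

/-! ### Balanced boxes as polynomials, and the derivative bound -/

open Polynomial

/-- The volume of the balanced box with side lengths summing to `N`, as a polynomial in `ℓ`. -/
noncomputable def balPoly (ℓ : ℕ) : ℕ → ℕ → ℤ[X]
  | 0, _ => 1
  | d + 1, N => (X - C ((ℓ : ℤ) - (N / (d + 1) : ℕ))) * balPoly ℓ d (N - N / (d + 1))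

theorem eval_balPoly (ℓ d N : ℕ) : (balPoly ℓ d N).eval (ℓ : ℤ) = balVol d N := by
  induction d generalizing N with
  | zero => simp [balPoly, balVol]
  | succ d ih =>
    simp only [balPoly, balVol, eval_mul, ih, eval_sub, eval_X, eval_C]
    push_cast; ring

theorem eval_derivative_balPoly (ℓ d N : ℕ) :
    (balPoly ℓ d N).derivative.eval (ℓ : ℤ) = balSurf d N := by
  induction d generalizing N with
  | zero => simp [balPoly, balSurf]
  | succ d ih =>
    simp only [balPoly, balSurf, derivative_mul, eval_add, eval_mul, ih, eval_sub, eval_X, eval_C,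
      derivative_sub, derivative_X, derivative_C, eval_one, eval_balPoly, sub_zero]
    push_cast; ring

theorem coeff_balPoly_of_lt {ℓ d N j : ℕ} (h : d < j) : (balPoly ℓ d N).coeff j = 0 := by
  induction d generalizing N j with
  | zero => rw [balPoly, coeff_one, if_neg (by omega)]
  | succ d ih =>
    obtain ⟨j, rfl⟩ : ∃ k, j = k + 1 := ⟨j - 1, by omega⟩
    rw [balPoly, sub_mul, coeff_sub, coeff_X_mul, coeff_C_mul, ih (by omega), ih (by omega)]
    simp

theorem coeff_balPoly_self (ℓ d N : ℕ) : (balPoly ℓ d N).coeff d = 1 := by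
  induction d generalizing N with
  | zero => simp [balPoly]
  | succ d ih =>
    rw [balPoly, sub_mul, coeff_sub, coeff_X_mul, coeff_C_mul, ih,
      coeff_balPoly_of_lt (Nat.lt_succ_self d)]
    simp

theorem coeff_balPoly_succ {ℓ d N s : ℕ} (h : N + s = (d + 1) * ℓ) :
    (balPoly ℓ (d + 1) N).coeff d = -s := by
  induction d generalizing N s with
  | zero =>
    simp only [balPoly, zero_add, Nat.div_one, mul_one, coeff_sub, coeff_X_zero, coeff_C_zero]
    simp at h
    omega
  | succ d ih =>
    obtain ⟨h1, h2⟩ := div_le_and_sub_div_le (d := d + 1) (ℓ := ℓ) (N := N) (by omega)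
    have h3 : N / (d + 1 + 1) ≤ N := Nat.div_le_self _ _
    rw [balPoly]
    generalize N / (d + 1 + 1) = k at *
    have h4 : (d + 1 + 1) * ℓ = (d + 1) * ℓ + ℓ := by ring
    rw [sub_mul, coeff_sub, coeff_X_mul, coeff_C_mul, coeff_balPoly_self,
      ih (N := N - k) (s := s - (ℓ - k)) (by omega)]
    omega

/-- Up to sign the coefficient is the m-th elementary symmetric function of the nonnegative side
deficits, which sum to s. It counts the m-subsets of s points meeting each block of a partition at
most once. -/
theorem abs_coeff_balPoly_le {ℓ d N s j m : ℕ} (h : N + s = d * ℓ) (hj : j + m = d) :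
    |(balPoly ℓ d N).coeff j| ≤ s.choose m := by
  induction d generalizing N s j m with
  | zero =>
    obtain rfl : j = 0 := by omega
    obtain rfl : m = 0 := by omega
    simp [balPoly]
  | succ d ih =>
    cases m with
    | zero =>
      obtain rfl : j = d + 1 := by omega
      simp [coeff_balPoly_self]
    | succ m =>
      obtain ⟨h1, h2⟩ := div_le_and_sub_div_le (d := d) (ℓ := ℓ) (N := N) (by omega)
      have h3 : N / (d + 1) ≤ N := Nat.div_le_self _ _
      rw [balPoly]
      generalize N / (d + 1) = k at *
      obtain ⟨z, rfl⟩ : ∃ z, ℓ = k + z := ⟨ℓ - k, by omega⟩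
      have h4 : (d + 1) * (k + z) = d * (k + z) + k + z := by ring
      obtain ⟨s, rfl⟩ : ∃ s', s = s' + z := ⟨s - z, by omega⟩
      have hb := ih (N := N - k) (s := s) (j := j) (m := m) (by omega) (by omega)
      have hc := choose_add_mul_choose_le s z m
      have hz : |(z : ℤ) * (balPoly (k + z) d (N - k)).coeff j| ≤ z * s.choose m := by
        rw [abs_mul, Nat.abs_cast]
        exact mul_le_mul_of_nonneg_left hb (Int.natCast_nonneg z)
      zify at hc
      rw [show (((k + z : ℕ) : ℤ) - (k : ℕ)) = z by push_cast; ring, sub_mul, coeff_sub,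
        coeff_C_mul]
      cases j with
      | zero =>
        rw [mul_coeff_zero, coeff_X_zero, zero_mul, zero_sub, abs_neg]
        have : (0 : ℤ) ≤ s.choose (m + 1) := Int.natCast_nonneg _
        omega
      | succ j =>
        rw [coeff_X_mul]
        have ha := ih (N := N - k) (s := s) (j := j) (m := m + 1) (by omega) (by omega)
        have := abs_sub ((balPoly (k + z) d (N - k)).coeff j)
          (z * (balPoly (k + z) d (N - k)).coeff (j + 1))
        omega

/-- The cascade value at `ℓ ^ i - h(ℓ)` is at least the derivative of `X ^ i - h` at `ℓ`, for all
polynomials `h` of degree less than `i` whose coefficients are small: at most `M` in degree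
`i - 1`, and at most `K.choose m` in degree `i - m` for `m ≥ 2`. -/
def CascadeDerivBound (ℓ i M K : ℕ) : Prop :=
  ∀ h : ℤ[X], (∀ j, i ≤ j → h.coeff j = 0) →
    (∀ j m, j + (m + 2) = i → h.coeff j ≤ K.choose (m + 2)) →
    (∀ j, j + 1 = i → h.coeff j ≤ M) → 0 ≤ h.eval (ℓ : ℤ) →
    ∃ n : ℕ, 0 < n ∧ (n : ℤ) = ℓ ^ i - h.eval (ℓ : ℤ) ∧
      i * (ℓ : ℤ) ^ (i - 1) - h.derivative.eval (ℓ : ℤ) ≤ cascade i n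

theorem eq_sum_range_of_coeff {i : ℕ} {h : ℤ[X]} (hh : ∀ j, i ≤ j → h.coeff j = 0) :
    h = ∑ j ∈ Finset.range i, C (h.coeff j) * X ^ j := by
  ext k
  simp only [finsetSum_coeff, coeff_C_mul, coeff_X_pow, mul_ite, mul_one, mul_zero,
    Finset.sum_ite_eq, Finset.mem_range]
  split_ifs with hk
  · rfl
  · exact hh k (by omega)

theorem eval_derivative_eq_sum_range {i : ℕ} {h : ℤ[X]} (hh : ∀ j, i ≤ j → h.coeff j = 0)
    (x : ℤ) :
    h.derivative.eval x = ∑ j ∈ Finset.range i, h.coeff j * (j * x ^ (j - 1)) := by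
  conv_lhs => rw [eq_sum_range_of_coeff hh]
  simp [eval_finsetSum, derivative_X_pow]

theorem eval_eq_sum_range_of_coeff {i : ℕ} {h : ℤ[X]} (hh : ∀ j, i ≤ j → h.coeff j = 0)
    (x : ℤ) : h.eval x = ∑ j ∈ Finset.range i, h.coeff j * x ^ j := by
  conv_lhs => rw [eq_sum_range_of_coeff hh]
  simp [eval_finsetSum]

theorem exists_posPart {i : ℕ} {h : ℤ[X]} (hh : ∀ j, i ≤ j → h.coeff j = 0) :
    ∃ q : ℤ[X], ∀ j, q.coeff j = (h.coeff j).toNat := by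
  refine ⟨∑ j ∈ Finset.range i, C ((h.coeff j).toNat : ℤ) * X ^ j, fun k => ?_⟩
  simp only [finsetSum_coeff, coeff_C_mul, coeff_X_pow, mul_ite, mul_one, mul_zero,
    Finset.sum_ite_eq, Finset.mem_range]
  split_ifs with hk
  · rfl
  · simp [hh k (by omega)]

/-- Replace h by its positive part q, peel off one balanced box, and apply the bound in dimension i
to what lies on the face. The negative coefficients of h are restored afterwards, as additional
points. -/
theorem CascadeDerivBound.succ {ℓ i M K : ℕ}
    (hM : (M + 1).choose 2 + K.choose 2 < ℓ)
    (ih : CascadeDerivBound ℓ i ((M + 1).choose 2 + K.choose 2)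
      ((M + 1).choose 2 + K.choose 2)) : CascadeDerivBound ℓ (i + 1) M K := by
  intro h h0 hK hM1 hpos
  have hℓ : 0 < ℓ := by omega
  obtain ⟨q, hq⟩ := exists_posPart h0
  have hq0 : ∀ j, i + 1 ≤ j → q.coeff j = 0 := fun j hj => by rw [hq, h0 j hj]; rfl
  obtain ⟨c, hc⟩ : ∃ c, c = (h.coeff i).toNat := ⟨_, rfl⟩
  have hcM : c ≤ M := by have := hM1 i rfl; omega
  have hMle : M ≤ (M + 1).choose 2 := by
    rw [Nat.choose_succ_succ' M 1, Nat.choose_one_right]; omega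
  have hcℓ : c + 1 ≤ (i + 1) * ℓ := by
    have : ℓ ≤ (i + 1) * ℓ := Nat.le_mul_of_pos_left ℓ (Nat.succ_pos i)
    omega
  -- The deficit c + 1 places ℓ^(i+1) - q(ℓ) above `balVol (i + 1) N` and at most at `balVol (i + 1)
  -- (N + 1)`.
  obtain ⟨N, hN⟩ : ∃ N, N + (c + 1) = (i + 1) * ℓ := ⟨(i + 1) * ℓ - (c + 1), by omega⟩
  have hvol : ℓ ^ (i + 1) ≤ balVol (i + 1) (N + 1) + c * ℓ ^ i :=
    pow_le_balVol_add (by omega)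
  have hstep := balVol_succ_succ_eq_add i N
  have hface : balVol i (N - N / (i + 1)) ≤ ℓ ^ i := by
    rw [← balVol_mul]
    exact balVol_mono i (div_le_and_sub_div_le (by omega)).2
  have hqc : (c : ℤ) * ℓ ^ i ≤ q.eval (ℓ : ℤ) := by
    rw [eval_eq_sum_range_of_coeff hq0, hc, ← hq]
    refine Finset.single_le_sum (f := fun j => q.coeff j * (ℓ : ℤ) ^ j) (fun j _ => ?_)
      (Finset.self_mem_range_succ i)
    simp only [hq]; positivity
  zify at hvol hstep hface
  have hg_eval : (X ^ i - X ^ (i + 1) + q + balPoly ℓ (i + 1) N).eval (ℓ : ℤ)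
      = ℓ ^ i - ℓ ^ (i + 1) + q.eval (ℓ : ℤ) + balVol (i + 1) N := by
    simp [eval_balPoly]
  have hg_der : (X ^ i - X ^ (i + 1) + q + balPoly ℓ (i + 1) N).derivative.eval (ℓ : ℤ)
      = i * (ℓ : ℤ) ^ (i - 1) - (i + 1) * ℓ ^ i + q.derivative.eval (ℓ : ℤ)
        + balSurf (i + 1) N := by
    simp [eval_derivative_balPoly, derivative_X_pow]
  have hbound : ∀ j m : ℕ, j + (m + 1) = i →
      (X ^ i - X ^ (i + 1) + q + balPoly ℓ (i + 1) N).coeff j ≤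
        ((((M + 1).choose 2 + K.choose 2).choose (m + 1) : ℕ) : ℤ) := by
    intro j m hj
    have h1 := (abs_le.1 (abs_coeff_balPoly_le (j := j) (m := m + 2) hN (by omega))).2
    have h2 := Nat.choose_le_choose (m + 2) (show c + 1 ≤ M + 1 by omega)
    have h3 := hK j m (by omega)
    have h4 := choose_le_choose_choose_two (M + 1) m
    have h5 := choose_le_choose_choose_two K m
    have h6 := choose_add_choose_le ((M + 1).choose 2) (K.choose 2) m
    simp only [coeff_add, coeff_sub, coeff_X_pow, hq]
    rw [if_neg (by omega), if_neg (by omega)]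
    omega
  -- The top coefficients cancel: -1 + 1 in degree i + 1, and 1 + c - (c + 1) in degree i.
  obtain ⟨r, hr, hrv, hrd⟩ := ih (X ^ i - X ^ (i + 1) + q + balPoly ℓ (i + 1) N) (by
      intro j hj
      simp only [coeff_add, coeff_sub, coeff_X_pow]
      rcases hj.lt_or_eq with hj | rfl
      · rw [if_neg (by omega), hq0 j hj]
        rcases (Nat.succ_le_iff.2 hj).lt_or_eq with hj | rfl
        · rw [if_neg (by omega), coeff_balPoly_of_lt hj]; rfl
        · rw [if_pos rfl, coeff_balPoly_self]; rfl
      · rw [if_pos rfl, if_neg (by omega), hq, ← hc, coeff_balPoly_succ hN]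
        push_cast; ring)
    (fun j m hj => hbound j (m + 1) hj)
    (fun j hj => by simpa using hbound j 0 hj)
    (by rw [hg_eval]; linarith)
  rw [hg_eval] at hrv
  rw [hg_der] at hrd
  have hcas := cascade_of_lt (d := i) (n := balVol (i + 1) N + r) (N := N) (by omega) (by
    zify; linarith)
  rw [Nat.add_sub_cancel_left] at hcas
  have hdiff : ∀ j, ((-(h.coeff j)).toNat : ℤ) = q.coeff j - h.coeff j := by
    intro j; rw [hq]; omega
  have hw_eval : ((∑ j ∈ Finset.range (i + 1), (-(h.coeff j)).toNat * ℓ ^ j : ℕ) : ℤ)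
      = q.eval (ℓ : ℤ) - h.eval (ℓ : ℤ) := by
    rw [eval_eq_sum_range_of_coeff hq0, eval_eq_sum_range_of_coeff h0, ← Finset.sum_sub_distrib]
    push_cast [hdiff]
    exact Finset.sum_congr rfl fun j _ => by ring
  have hw_der : ((∑ j ∈ Finset.range (i + 1), (-(h.coeff j)).toNat * (j * ℓ ^ (j - 1)) : ℕ) : ℤ)
      = q.derivative.eval (ℓ : ℤ) - h.derivative.eval (ℓ : ℤ) := by
    rw [eval_derivative_eq_sum_range hq0, eval_derivative_eq_sum_range h0,
      ← Finset.sum_sub_distrib]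
    push_cast [hdiff]
    exact Finset.sum_congr rfl fun j _ => by ring
  -- Adding back q - h keeps the total at most ℓ^(i+1) because h(ℓ) ≥ 0.
  have hstrip := cascade_add_sum_pow_le hℓ le_rfl (fun j => (-(h.coeff j)).toNat)
    (i := i + 1) (y := balVol (i + 1) N + r) (by zify at hw_eval ⊢; linarith)
  refine ⟨_, ?_, ?_, le_trans ?_ (Int.ofNat_le.2 hstrip)⟩
  · omega
  · rw [Nat.cast_add, hw_eval]; push_cast; linarith
  · rw [Nat.cast_add (cascade _ _), hw_der, hcas, Nat.add_sub_cancel]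
    push_cast
    linarith

theorem cascadeDerivBound_one {ℓ M : ℕ} (hM : M < ℓ) (K : ℕ) : CascadeDerivBound ℓ 1 M K := by
  intro h h0 _ hM1 hpos
  have h1 := hM1 0 rfl
  have he := eval_eq_sum_range_of_coeff h0 ℓ
  have hd := eval_derivative_eq_sum_range h0 ℓ
  simp at he hd
  rw [he] at hpos
  refine ⟨(ℓ - h.coeff 0).toNat, by omega, by rw [he]; simp; omega, ?_⟩
  have hn : 0 < (ℓ - h.coeff 0).toNat := by omega
  generalize (ℓ - h.coeff 0).toNat = n at hn
  rw [hd, cascade_of_lt (d := 0) (n := n) (N := n - 1) (by simp [balVol]; omega)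
    (by simp [balVol]; omega)]
  simp [balSurf, balVol]

/-- With equal bounds M = K, one peeling squares them exactly: C(M+1, 2) + C(M, 2) = M^2. -/
theorem cascadeDerivBound_of_pow_lt {ℓ i M : ℕ} (h : M ^ 2 ^ i < ℓ) :
    CascadeDerivBound ℓ (i + 1) M M := by
  induction i generalizing M with
  | zero => exact cascadeDerivBound_one (by simpa using h) M
  | succ i ih =>
    have hsq : (M + 1).choose 2 + M.choose 2 = M ^ 2 := by
      have h1 := Nat.choose_succ_succ' M 1
      have h3 := Nat.choose_two_right M
      rw [Nat.choose_one_right] at h1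
      have h5 : M.choose 2 * 2 = M * (M - 1) := by
        rw [h3]; exact Nat.div_mul_cancel (Nat.even_mul_pred_self M).two_dvd
      rcases M with _ | M
      · simp
      · simp at h5 h1 ⊢; nlinarith
    have hpow : (M ^ 2) ^ 2 ^ i < ℓ := by rwa [← pow_mul, ← pow_succ']
    refine CascadeDerivBound.succ ?_ (by rw [hsq]; exact ih hpow)
    rw [hsq]
    exact (Nat.le_self_pow (by positivity) _).trans_lt hpow

/-- The first peeling starts from K = 0 and gives only C(p+1, 2), which is less than p^2 for p ≥ 2.
This turns the non-strict hypothesis into the strict one required below; for p < 2 strictness comes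
from p < ℓ. -/
theorem cascadeDerivBound_zero_of_pow_le {ℓ e p : ℕ} (hpℓ : p < ℓ) (h : p ^ 2 ^ (e + 1) ≤ ℓ) :
    CascadeDerivBound ℓ (e + 2) p 0 := by
  have hlt : ((p + 1).choose 2 + Nat.choose 0 2) ^ 2 ^ e < ℓ := by
    rcases Nat.lt_or_ge p 2 with hp | hp
    · interval_cases p
      · simpa using hpℓ
      · simpa using hpℓ
    · refine lt_of_lt_of_le (Nat.pow_lt_pow_left (b := p ^ 2) ?_ (by positivity)) ?_
      · have h5 : (p + 1).choose 2 * 2 = (p + 1) * p := by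
          rw [Nat.choose_two_right, Nat.add_sub_cancel]
          exact Nat.div_mul_cancel (Nat.even_mul_pred_self (p + 1)).two_dvd
        simp; nlinarith
      · rwa [← pow_mul, ← pow_succ']
  exact CascadeDerivBound.succ ((Nat.le_self_pow (by positivity) _).trans_lt hlt)
    (cascadeDerivBound_of_pow_lt hlt)

theorem le_cascade_of_pow_le {ℓ e p : ℕ} (hpℓ : p < ℓ) (h : p ^ 2 ^ (e + 1) ≤ ℓ) :
    ℓ ^ (e + 1) + (e + 1) * ((ℓ - p) * ℓ ^ e) ≤ cascade (e + 2) ((ℓ - p) * ℓ ^ (e + 1)) := by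
  obtain ⟨n, -, hn, hd⟩ := cascadeDerivBound_zero_of_pow_le hpℓ h (C (p : ℤ) * X ^ (e + 1))
    (fun j hj => by rw [coeff_C_mul, coeff_X_pow, if_neg (by omega), mul_zero])
    (fun j m hj => by rw [coeff_C_mul, coeff_X_pow, if_neg (by omega), mul_zero]; positivity)
    (fun j hj => by rw [coeff_C_mul, coeff_X_pow, if_pos (by omega), mul_one])
    (by simp only [eval_mul, eval_C, eval_pow, eval_X]; positivity)
  obtain ⟨k, rfl⟩ : ∃ k, ℓ = k + p := ⟨ℓ - p, by omega⟩
  have hn' : n = (k + p - p) * (k + p) ^ (e + 1) := by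
    rw [Nat.add_sub_cancel]
    zify
    rw [hn]
    simp only [eval_mul, eval_C, eval_pow, eval_X]
    push_cast; ring
  rw [← hn', Nat.add_sub_cancel]
  zify
  refine le_trans (le_of_eq ?_) hd
  simp
  ring

/-! ### The exponent condition and the given box -/

theorem pow_le_of_le_floor_hParam {d ℓ p : ℕ} (hp : p ≤ ⌊hParam ℓ (d + 1)⌋₊) : p ^ 2 ^ d ≤ ℓ := by
  have h0 : 0 ≤ hParam ℓ (d + 1) := Real.rpow_nonneg (Nat.cast_nonneg _) _
  have h1 : (p : ℝ) ≤ hParam ℓ (d + 1) := (Nat.le_floor_iff h0).1 hp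
  have h2 : (p : ℝ) ^ 2 ^ d ≤ hParam ℓ (d + 1) ^ 2 ^ d := by gcongr
  have h3 : hParam ℓ (d + 1) ^ 2 ^ d = ℓ := by
    rw [hParam, ← Real.rpow_natCast, ← Real.rpow_mul (Nat.cast_nonneg _)]
    have : (2 : ℝ) ^ (1 - ((d + 1 : ℕ) : ℝ)) * ((2 ^ d : ℕ) : ℝ) = 1 := by
      push_cast
      rw [← Real.rpow_natCast 2 d, ← Real.rpow_add (by norm_num)]
      simp
    rw [this, Real.rpow_one]
  rw [h3] at h2
  exact_mod_cast h2

theorem card_boxP {e ℓ p : ℕ} : (boxP ℓ (e + 2) p).card = (ℓ - p) * ℓ ^ (e + 1) := by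
  rw [boxP, Fintype.card_piFinset, Fin.prod_univ_succ]
  simp

theorem sum_prod_sides_boxP (e ℓ p : ℕ) :
    ∑ i : Fin (e + 2), ∏ j ∈ Finset.univ.erase i,
      ((if (j : ℕ) = 0 then (ℓ : ℤ) - p else ℓ) : ℤ).toNat
      = ℓ ^ (e + 1) + (e + 1) * ((ℓ - p) * ℓ ^ e) := by
  rw [Fin.sum_univ_succ]
  congr 1
  · rw [Finset.prod_congr rfl (g := fun _ => ℓ)]
    · simp
    · intro j hj
      have : (j : ℕ) ≠ 0 := fun hc => Finset.ne_of_mem_erase hj (Fin.ext hc)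
      simp [this]
  · rw [Finset.sum_congr rfl (g := fun _ => (ℓ - p) * ℓ ^ e)]
    · simp
    · intro i _
      have h0 : (0 : Fin (e + 2)) ∈ Finset.univ.erase i.succ :=
        Finset.mem_erase.2 ⟨(Fin.succ_ne_zero i).symm, Finset.mem_univ _⟩
      rw [← Finset.mul_prod_erase _ _ h0, Finset.prod_congr rfl (g := fun _ => ℓ)]
      · rw [Finset.prod_const, Finset.card_erase_of_mem h0,
          Finset.card_erase_of_mem (Finset.mem_univ _)]
        simp
      · intro j hj
        have : (j : ℕ) ≠ 0 := fun hc => Finset.ne_of_mem_erase hj (Fin.ext hc)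
        simp [this]

theorem lemma3p5 (d : ℕ) (hd : 2 ≤ d) (ℓ p : ℕ) (hp : p ≤ ⌊hParam ℓ d⌋₊) :
    IsEIPMinimizer (boxP ℓ d p) := by
  obtain ⟨e, rfl⟩ : ∃ e, d = e + 2 := ⟨d - 2, by omega⟩
  have hpow := pow_le_of_le_floor_hParam hp
  rcases Nat.lt_or_ge p ℓ with hlt | hge
  · apply isEIPMinimizer_of_le_cascade
    refine (edgePerimeter_piFinset_Icc_le _).trans (Nat.mul_le_mul_left 2 ?_)
    rw [card_boxP, sum_prod_sides_boxP]
    exact le_cascade_of_pow_le hlt hpow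
  · left
    rw [← Finset.card_eq_zero, card_boxP, Nat.sub_eq_zero_of_le hge, zero_mul]
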